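/- Proposition (Extreme value theorem for Brownian motion). Let $W=(W_t)_{t\ge 0}$ be a standard one-dimensional Brownian motion on a probability space $(\Omega,\mathcal F,\mathbb P)$. For $\varepsilon>0$ let $$A_\varepsilon=\Big\{\max_{0\le t\le 1}W_t\ge \tfrac1\varepsilon\Big\}.$$ Then $\mathbb P(A_\varepsilon)>0$ for every $\varepsilon>0$. Let $\mathbb P^\varepsilon$ be the conditional probability measure $\mathbb P^\varepsilon(E)=\mathbb P(E\cap A_\varepsilon)/\mathbb P(A_\varepsilon)$, $E\in\mathcal F$, and let $\mathbb E_{\mathbb P^\varepsilon}$ be the expectation under $\mathbb P^\varepsilon$. For every $\varepsilon>0$ the random variable $\varepsilon W_1-1$ is $\mathbb P^\varepsilon$-integrable and $$\mathbb E_{\mathbb P^\varepsilon}\big[\,|\varepsilon W_1-1|\,\big]\le \varepsilon\sqrt{\tfrac{2}{\pi}} .$$ In particular, $$\lim_{\varepsilon\downarrow 0}\mathbb E_{\mathbb P^\varepsilon}\big[\,|\varepsilon W_1-1|\,\big]=0 .$$ -/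

import Mathlib

open MeasureTheory ProbabilityTheory Filter Topology
open scoped NNReal

/-- The running maximum of the path `t ↦ W t ω` over the time interval `[0, 1]`. (On a continuous
path the supremum is attained, so it is the maximum.) -/
noncomputable def runningMax {Ω : Type*} (W : ℝ≥0 → Ω → ℝ) (ω : Ω) : ℝ :=
  sSup ((fun t : ℝ≥0 => W t ω) '' Set.Icc 0 1)

/-- The event that the running maximum of `W` over `[0, 1]` is at least `1 / ε`. -/
def highMaxEvent {Ω : Type*} (W : ℝ≥0 → Ω → ℝ) (ε : ℝ) : Set Ω :=
  {ω | 1 / ε ≤ runningMax W ω}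

open scoped ENNReal

/-!
Fix a level `b` and a finite grid of `[0, 1]`, and let `τ` be the first grid time at which the path
is at least `b`. The increment `W 1 - W τ` is independent of the path up to `τ`, so summing over the
possible values of `τ` bounds `𝔼[|W 1 - W τ|; τ ≤ 1]` by `√(2 / π) ℙ(τ ≤ 1)`; only independence of
the future increments from the past and a uniform bound on `𝔼|W 1 - W t|` matter here. As the grid
is refined, continuity forces `W τ → b` on `{b < max W}`, and Fatou's lemma gives
`𝔼[|W 1 - b|; b < max W] ≤ √(2 / π) ℙ(b ≤ max W)`. Letting `b ↑ 1 / ε` turns both events into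
`{1 / ε ≤ max W}`, and it remains to divide by the probability of this event and scale by `ε`.
-/

section Measure

variable {Ω : Type*} [MeasurableSpace Ω] {μ : Measure Ω}

lemma tendsto_measure_le_of_monotone [IsFiniteMeasure μ] {f : Ω → ℝ} (hf : AEMeasurable f μ)
    {u : ℕ → ℝ} (hu : Monotone u) {a : ℝ} (hua : Tendsto u atTop (𝓝 a)) :
    Tendsto (fun n ↦ μ {ω | u n ≤ f ω}) atTop (𝓝 (μ {ω | a ≤ f ω})) := by
  have hInter : {ω | a ≤ f ω} = ⋂ n, {ω | u n ≤ f ω} := by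
    ext ω
    simpa using ⟨fun h n ↦ (hu.ge_of_tendsto hua n).trans h, le_of_tendsto' hua⟩
  rw [hInter]
  exact tendsto_measure_iInter_atTop (fun n ↦ nullMeasurableSet_le aemeasurable_const hf)
    (fun i j hij ω hω ↦ (hu hij).trans hω) ⟨0, measure_ne_top _ _⟩

lemma lintegral_le_of_tendsto_of_forall_lintegral_le {F : ℕ → Ω → ℝ≥0∞} {f : Ω → ℝ≥0∞}
    {C : ℕ → ℝ≥0∞} {c : ℝ≥0∞} (hF : ∀ n, AEMeasurable (F n) μ)
    (hFf : ∀ᵐ ω ∂μ, Tendsto (F · ω) atTop (𝓝 (f ω))) (hFC : ∀ n, ∫⁻ ω, F n ω ∂μ ≤ C n)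
    (hC : Tendsto C atTop (𝓝 c)) : ∫⁻ ω, f ω ∂μ ≤ c :=
  calc ∫⁻ ω, f ω ∂μ = ∫⁻ ω, liminf (F · ω) atTop ∂μ :=
        lintegral_congr_ae (hFf.mono fun _ h ↦ h.liminf_eq.symm)
    _ ≤ liminf (fun n ↦ ∫⁻ ω, F n ω ∂μ) atTop := lintegral_liminf_le' hF
    _ ≤ liminf C atTop := liminf_le_liminf (.of_forall hFC)
    _ = c := hC.liminf_eq

lemma lintegral_cond_le_of_setLIntegral_le {f : Ω → ℝ≥0∞} {A : Set Ω} {c : ℝ≥0∞}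
    (h : ∫⁻ ω in A, f ω ∂μ ≤ c * μ A) : ∫⁻ ω, f ω ∂μ[|A] ≤ c := by
  rw [ProbabilityTheory.cond, lintegral_smul_measure, smul_eq_mul, mul_comm, ← div_eq_mul_inv]
  exact ENNReal.div_le_of_le_mul h

lemma lintegral_enorm_mul_sub_one (f : Ω → ℝ) {ε : ℝ} (hε : ε ≠ 0) :
    ∫⁻ ω, ‖ε * f ω - 1‖ₑ ∂μ = ‖ε‖ₑ * ∫⁻ ω, ‖f ω - 1 / ε‖ₑ ∂μ := by
  rw [← lintegral_const_mul' _ _ enorm_ne_top]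
  congr with ω
  rw [← enorm_mul, mul_sub, mul_one_div_cancel hε]

lemma integrable_and_integral_abs_le_of_lintegral_enorm_le {f : Ω → ℝ}
    (hf : AEStronglyMeasurable f μ) {r : ℝ} (hr : 0 ≤ r)
    (h : ∫⁻ ω, ‖f ω‖ₑ ∂μ ≤ ENNReal.ofReal r) :
    Integrable (fun ω ↦ |f ω|) μ ∧ ∫ ω, |f ω| ∂μ ≤ r := by
  have hint : Integrable f μ := ⟨hf, h.trans_lt ENNReal.ofReal_lt_top⟩
  refine ⟨hint.abs, ?_⟩
  rw [← ENNReal.ofReal_le_ofReal_iff hr]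
  exact (ofReal_integral_norm_eq_lintegral_enorm hint).trans_le h

end Measure

section Gaussian

lemma integral_Ioi_mul_exp_neg_mul_sq {b : ℝ} (hb : 0 < b) :
    ∫ x in Set.Ioi (0 : ℝ), x * Real.exp (-(b * x ^ 2)) = (2 * b)⁻¹ := by
  calc ∫ x in Set.Ioi (0 : ℝ), x * Real.exp (-(b * x ^ 2))
      = ∫ x in Set.Ioi (0 : ℝ), x ^ (1 : ℝ) * Real.exp (-b * x ^ (2 : ℝ)) := by simp
    _ = b ^ (-(1 + 1) / 2 : ℝ) * (1 / 2) * Real.Gamma ((1 + 1) / 2) :=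
        integral_rpow_mul_exp_neg_mul_rpow two_pos (by norm_num) hb
    _ = (2 * b)⁻¹ := by norm_num [Real.rpow_neg_one, mul_comm]

lemma integral_abs_sub_gaussianReal (m : ℝ) (v : ℝ≥0) :
    ∫ x, |x - m| ∂(gaussianReal m v) = √(2 * v / Real.pi) := by
  rcases eq_or_ne v 0 with rfl | hv
  · simp
  calc ∫ x, |x - m| ∂(gaussianReal m v)
      = (√(2 * Real.pi * v))⁻¹ *
          ∫ x, |x - m| * Real.exp (-((2 * (v : ℝ))⁻¹ * |x - m| ^ 2)) := by
        rw [integral_gaussianReal_eq_integral_smul hv, ← integral_const_mul]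
        congr with x
        rw [gaussianPDFReal, smul_eq_mul, sq_abs, neg_div, div_eq_inv_mul]
        ring
    _ = (√(2 * Real.pi * v))⁻¹ * (2 * v) := by
        rw [integral_sub_right_eq_self
            (fun x ↦ |x| * Real.exp (-((2 * (v : ℝ))⁻¹ * |x| ^ 2))) m,
          integral_comp_abs (f := fun x ↦ x * Real.exp (-((2 * (v : ℝ))⁻¹ * x ^ 2))),
          integral_Ioi_mul_exp_neg_mul_sq (by positivity)]
        field_simp
    _ = √(2 * v / Real.pi) := by
        symm
        rw [Real.sqrt_eq_iff_mul_self_eq (by positivity) (by positivity), mul_mul_mul_comm,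
          ← mul_inv, Real.mul_self_sqrt (by positivity)]
        field_simp

end Gaussian

section UniformGrid

/-- The `k`-th point of the subdivision of `[0, 1]` into `n + 1` intervals of equal length. All
points with index `k ≥ n + 1` coincide with `1`, so that the grid is an infinite sequence. -/
noncomputable def uniformGrid (n k : ℕ) : ℝ≥0 := min (k / (n + 1)) 1

lemma uniformGrid_zero (n : ℕ) : uniformGrid n 0 = 0 := by simp [uniformGrid]

lemma uniformGrid_le_one (n k : ℕ) : uniformGrid n k ≤ 1 := min_le_right _ _

lemma monotone_uniformGrid (n : ℕ) : Monotone (uniformGrid n) := fun j k hjk ↦ by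
  unfold uniformGrid
  gcongr

lemma dist_uniformGrid_succ_le (n k : ℕ) :
    dist (uniformGrid n (k + 1)) (uniformGrid n k) ≤ 1 / ((n : ℝ) + 1) := by
  rw [NNReal.dist_eq, uniformGrid, uniformGrid]
  push_cast
  refine (abs_min_sub_min_le_max _ _ _ _).trans ?_
  rw [← sub_div, add_sub_cancel_left, sub_self, abs_zero, abs_of_pos (by positivity)]
  exact max_le le_rfl (by positivity)

lemma tendsto_uniformGrid_floor {t : ℝ≥0} (ht : t ≤ 1) :
    Tendsto (fun n : ℕ ↦ uniformGrid n ⌊(t : ℝ) * (n + 1)⌋₊) atTop (𝓝 t) := by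
  have hfloor : Tendsto (fun n : ℕ ↦ (⌊(t : ℝ) * (n + 1)⌋₊ / (n + 1) : ℝ)) atTop (𝓝 t) :=
    (tendsto_nat_floor_mul_div_atTop t.2).comp
      (tendsto_atTop_add_const_right _ 1 tendsto_natCast_atTop_atTop)
  rw [← NNReal.tendsto_coe]
  simpa [uniformGrid, ht] using hfloor.min (tendsto_const_nhds (x := (1 : ℝ)))

lemma eventually_forall_dist_uniformGrid_succ_le {E : Type*} [PseudoMetricSpace E] {f : ℝ≥0 → E}
    (hf : ContinuousOn f (Set.Icc 0 1)) {δ : ℝ} (hδ : 0 < δ) :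
    ∀ᶠ n in atTop, ∀ k, dist (f (uniformGrid n (k + 1))) (f (uniformGrid n k)) ≤ δ := by
  have huc : UniformContinuousOn f (Set.Icc 0 1) :=
    isCompact_Icc.uniformContinuousOn_of_continuous hf
  obtain ⟨η, hη, hfη⟩ := Metric.uniformContinuousOn_iff.1 huc δ hδ
  filter_upwards [tendsto_one_div_add_atTop_nhds_zero_nat.eventually_lt_const hη] with n hn k
  exact (hfη _ ⟨zero_le, uniformGrid_le_one _ _⟩ _ ⟨zero_le, uniformGrid_le_one _ _⟩
    ((dist_uniformGrid_succ_le n k).trans_lt hn)).le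

lemma eventually_exists_lt_uniformGrid {E : Type*} [LinearOrder E] [TopologicalSpace E]
    [ClosedIicTopology E] {f : ℝ≥0 → E} {b : E} {t : ℝ≥0} (hf : ContinuousAt f t) (ht : t ≤ 1)
    (hb : b < f t) : ∀ᶠ n in atTop, ∃ k, b < f (uniformGrid n k) :=
  ((hf.tendsto.comp (tendsto_uniformGrid_floor ht)).eventually_const_lt hb).mono
    fun _ hn ↦ ⟨_, hn⟩

lemma tendsto_apply_uniformGrid_first_passage {f : ℝ≥0 → ℝ} (hf : Continuous f) {b : ℝ}
    (h0 : f 0 < b) {k : ℕ → ℕ}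
    (hk : ∀ᶠ n in atTop, b ≤ f (uniformGrid n (k n)) ∧ ∀ j < k n, f (uniformGrid n j) < b) :
    Tendsto (fun n ↦ f (uniformGrid n (k n))) atTop (𝓝 b) := by
  have overshoot_le : ∀ δ > 0, ∀ᶠ n in atTop, f (uniformGrid n (k n)) ≤ b + δ := fun δ hδ ↦ by
    filter_upwards [hk, eventually_forall_dist_uniformGrid_succ_le hf.continuousOn hδ]
      with n ⟨hb, hlt⟩ hincr
    obtain hzero | ⟨j, hj⟩ : k n = 0 ∨ ∃ j, k n = j + 1 := by cases k n <;> simp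
    · rw [hzero, uniformGrid_zero] at hb
      exact absurd h0 hb.not_gt
    · rw [hj] at hlt ⊢
      linarith [(abs_le.1 (hincr j)).2, hlt j j.lt_succ_self]
  rw [Metric.tendsto_nhds]
  intro δ hδ
  filter_upwards [hk, overshoot_le (δ / 2) (half_pos hδ)] with n ⟨hb, _⟩ hle
  rw [Real.dist_eq, abs_of_nonneg (sub_nonneg.2 hb)]
  linarith

end UniformGrid

section FirstHit

variable {Ω E : Type*}

/-- The event that the sequence `X` visits the set `S` for the first time at index `k`. -/
def firstHit (X : ℕ → Ω → E) (S : Set E) : ℕ → Set Ω := disjointed fun k ↦ X k ⁻¹' S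

lemma pairwise_disjoint_firstHit (X : ℕ → Ω → E) (S : Set E) :
    Pairwise (Function.onFun Disjoint (firstHit X S)) :=
  disjoint_disjointed _

lemma iUnion_firstHit (X : ℕ → Ω → E) (S : Set E) :
    ⋃ k, firstHit X S k = ⋃ k, X k ⁻¹' S :=
  iUnion_disjointed

lemma mem_firstHit_iff {X : ℕ → Ω → E} {S : Set E} {k : ℕ} {ω : Ω} :
    ω ∈ firstHit X S k ↔ X k ω ∈ S ∧ ∀ j < k, X j ω ∉ S := by
  simp [firstHit, disjointed_eq_inter_compl]

lemma firstHit_eq_preimage (X : ℕ → Ω → E) (S : Set E) (k : ℕ) :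
    firstHit X S k = (fun ω (j : Set.Iic k) ↦ X j ω) ⁻¹'
      (Function.eval ⟨k, Set.self_mem_Iic⟩ ⁻¹' S ∩
        ⋂ j : Set.Iio k, Function.eval ⟨j, Set.Iio_subset_Iic_self j.2⟩ ⁻¹' Sᶜ) := by
  ext ω
  simp [mem_firstHit_iff]

lemma tsum_indicator_firstHit_of_mem {X : ℕ → Ω → E} {S : Set E} {k : ℕ} {ω : Ω}
    (hω : ω ∈ firstHit X S k) (g : ℕ → Ω → ℝ≥0∞) :
    ∑' j, (firstHit X S j).indicator (g j) ω = g k ω := by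
  rw [tsum_eq_single k fun j hj ↦ Set.indicator_of_notMem
    (Set.disjoint_right.1 (pairwise_disjoint_firstHit X S hj) hω) _, Set.indicator_of_mem hω]

variable [MeasurableSpace Ω] [MeasurableSpace E] {P : Measure Ω}

lemma nullMeasurableSet_firstHit {X : ℕ → Ω → E} (hX : ∀ k, AEMeasurable (X k) P) {S : Set E}
    (hS : MeasurableSet S) (k : ℕ) : NullMeasurableSet (firstHit X S k) P :=
  .disjointed (fun j ↦ (hX j).nullMeasurable hS) k

lemma setLIntegral_preimage_eq_mul_of_indepFun {f : Ω → ℝ≥0∞} {Y : Ω → E}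
    (hf : AEMeasurable f P) (hY : AEMeasurable Y P) (hfY : IndepFun f Y P) {S : Set E}
    (hS : MeasurableSet S) : ∫⁻ ω in Y ⁻¹' S, f ω ∂P = (∫⁻ ω, f ω ∂P) * P (Y ⁻¹' S) := by
  have hYS : NullMeasurableSet (Y ⁻¹' S) P := hY.nullMeasurable hS
  have hone : Measurable (S.indicator (1 : E → ℝ≥0∞)) := measurable_one.indicator hS
  calc ∫⁻ ω in Y ⁻¹' S, f ω ∂P = ∫⁻ ω, f ω * S.indicator 1 (Y ω) ∂P := by
        rw [← lintegral_indicator₀ hYS]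
        congr with ω
        by_cases hω : Y ω ∈ S <;> simp [hω]
    _ = (∫⁻ ω, f ω ∂P) * ∫⁻ ω, (Y ⁻¹' S).indicator 1 ω ∂P :=
        lintegral_mul_eq_lintegral_mul_lintegral_of_indepFun'' hf (hone.comp_aemeasurable hY)
          (hfY.comp measurable_id hone)
    _ = (∫⁻ ω, f ω ∂P) * P (Y ⁻¹' S) := by rw [lintegral_indicator_one₀ hYS]

lemma setLIntegral_firstHit_eq_mul {X : ℕ → Ω → E} (hX : ∀ k, AEMeasurable (X k) P) {S : Set E}
    (hS : MeasurableSet S) {k : ℕ} {f : Ω → ℝ≥0∞} (hf : AEMeasurable f P)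
    (hindep : IndepFun f (fun ω (j : Set.Iic k) ↦ X j ω) P) :
    ∫⁻ ω in firstHit X S k, f ω ∂P = (∫⁻ ω, f ω ∂P) * P (firstHit X S k) := by
  rw [firstHit_eq_preimage]
  refine setLIntegral_preimage_eq_mul_of_indepFun hf
    (aemeasurable_pi_lambda _ fun j : Set.Iic k ↦ hX j) hindep ?_
  exact (measurable_pi_apply _ hS).inter (.iInter fun j ↦ measurable_pi_apply _ hS.compl)

lemma lintegral_tsum_indicator_firstHit_le {X : ℕ → Ω → E} (hX : ∀ k, AEMeasurable (X k) P)
    {S : Set E} (hS : MeasurableSet S) {g : ℕ → Ω → ℝ≥0∞} (hg : ∀ k, AEMeasurable (g k) P)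
    (hindep : ∀ k, IndepFun (g k) (fun ω (j : Set.Iic k) ↦ X j ω) P) {c : ℝ≥0∞}
    (hc : ∀ k, ∫⁻ ω, g k ω ∂P ≤ c) :
    ∫⁻ ω, ∑' k, (firstHit X S k).indicator (g k) ω ∂P ≤ c * P (⋃ k, X k ⁻¹' S) := by
  have hnull := nullMeasurableSet_firstHit hX hS
  calc ∫⁻ ω, ∑' k, (firstHit X S k).indicator (g k) ω ∂P
      = ∑' k, (∫⁻ ω, g k ω ∂P) * P (firstHit X S k) := by
        rw [lintegral_tsum fun k ↦ (hg k).indicator₀ (hnull k)]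
        congr with k
        rw [lintegral_indicator₀ (hnull k), setLIntegral_firstHit_eq_mul hX hS (hg k) (hindep k)]
    _ ≤ ∑' k, c * P (firstHit X S k) := by
        gcongr with k
        exact hc k
    _ = c * P (⋃ k, X k ⁻¹' S) := by
        rw [ENNReal.tsum_mul_left, ← iUnion_firstHit,
          measure_iUnion₀ (pairwise_disjoint_firstHit X S).aedisjoint hnull]

end FirstHit

section RunningMax

variable {Ω : Type*} {X : ℝ≥0 → Ω → ℝ}

lemma le_runningMax {ω : Ω} (hω : Continuous (X · ω)) {t : ℝ≥0} (ht : t ≤ 1) :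
    X t ω ≤ runningMax X ω :=
  le_csSup (isCompact_Icc.image hω).bddAbove ⟨t, ⟨zero_le, ht⟩, rfl⟩

lemma exists_lt_of_lt_runningMax {ω : Ω} {b : ℝ} (hb : b < runningMax X ω) :
    ∃ t ≤ 1, b < X t ω := by
  obtain ⟨_, ⟨t, ht, rfl⟩, hbt⟩ := exists_lt_of_lt_csSup ((Set.nonempty_Icc.2 zero_le).image _) hb
  exact ⟨t, ht.2, hbt⟩

variable [MeasurableSpace Ω] {P : Measure Ω}

lemma aemeasurable_runningMax (hX : ∀ t, AEMeasurable (X t) P)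
    (hcont : ∀ᵐ ω ∂P, Continuous (X · ω)) : AEMeasurable (runningMax X) P := by
  obtain ⟨D, hD, hD_dense⟩ := TopologicalSpace.exists_countable_dense (Set.Icc (0 : ℝ≥0) 1)
  have := hD.to_subtype
  refine (AEMeasurable.iSup fun t : D ↦ hX t).congr ?_
  filter_upwards [hcont] with ω hω
  rw [runningMax, sSup_image', hD_dense.ciSup' (f := fun t : Set.Icc (0 : ℝ≥0) 1 ↦ X t ω)
    (by fun_prop)]

end RunningMax

section PassageLevel

variable {Ω : Type*} {X : ℝ≥0 → Ω → ℝ}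

lemma tendsto_tsum_indicator_firstHit_uniformGrid {ω : Ω} (hω : Continuous (X · ω)) {b : ℝ}
    (h0 : X 0 ω < b) (hb : b < runningMax X ω) :
    Tendsto (fun n ↦ ∑' k, (firstHit (fun k ↦ X (uniformGrid n k)) (Set.Ici b) k).indicator
      (fun ω ↦ ‖X 1 ω - X (uniformGrid n k) ω‖ₑ) ω) atTop (𝓝 ‖X 1 ω - b‖ₑ) := by
  obtain ⟨t, ht, hbt⟩ := exists_lt_of_lt_runningMax hb
  have exists_firstHit : ∀ᶠ n in atTop,
      ∃ k, ω ∈ firstHit (fun k ↦ X (uniformGrid n k)) (Set.Ici b) k := by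
    filter_upwards [eventually_exists_lt_uniformGrid hω.continuousAt ht hbt] with n ⟨k, hk⟩
    rw [← Set.mem_iUnion, iUnion_firstHit]
    exact Set.mem_iUnion.2 ⟨k, hk.le⟩
  obtain ⟨k, hk⟩ := exists_firstHit.choice
  have passage_value : Tendsto (fun n ↦ X (uniformGrid n (k n)) ω) atTop (𝓝 b) :=
    tendsto_apply_uniformGrid_first_passage hω h0 <| hk.mono fun n hn ↦ by
      simpa [mem_firstHit_iff] using hn
  refine (tendsto_const_nhds.sub passage_value).enorm.congr' ?_
  filter_upwards [hk] with n hn using (tsum_indicator_firstHit_of_mem hn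
    fun k ω ↦ ‖X 1 ω - X (uniformGrid n k) ω‖ₑ).symm

variable [MeasurableSpace Ω] {P : Measure Ω} {c : ℝ≥0∞}

lemma lintegral_tsum_indicator_firstHit_uniformGrid_le (hX : ∀ t, AEMeasurable (X t) P)
    (hcont : ∀ᵐ ω ∂P, Continuous (X · ω))
    (hindep : ∀ t ≤ 1, IndepFun (X 1 - X t) (fun ω (s : Set.Iic t) ↦ X s ω) P)
    (hc : ∀ t ≤ 1, ∫⁻ ω, ‖X 1 ω - X t ω‖ₑ ∂P ≤ c) (b : ℝ) (n : ℕ) :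
    ∫⁻ ω, ∑' k, (firstHit (fun k ↦ X (uniformGrid n k)) (Set.Ici b) k).indicator
        (fun ω ↦ ‖X 1 ω - X (uniformGrid n k) ω‖ₑ) ω ∂P
      ≤ c * P {ω | b ≤ runningMax X ω} := by
  have hindep_grid (k : ℕ) : IndepFun (fun ω ↦ ‖X 1 ω - X (uniformGrid n k) ω‖ₑ)
      (fun ω (j : Set.Iic k) ↦ X (uniformGrid n j) ω) P :=
    (hindep _ (uniformGrid_le_one n k)).comp measurable_enorm (measurable_pi_lambda
      (fun (x : Set.Iic (uniformGrid n k) → ℝ) (j : Set.Iic k) ↦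
        x ⟨uniformGrid n j, monotone_uniformGrid n j.2⟩) fun _ ↦ measurable_pi_apply _)
  refine (lintegral_tsum_indicator_firstHit_le (fun k ↦ hX _) measurableSet_Ici
    (fun k ↦ ((hX 1).sub (hX _)).enorm) hindep_grid
    fun k ↦ hc _ (uniformGrid_le_one n k)).trans ?_
  gcongr c * ?_
  refine measure_mono_ae ?_
  filter_upwards [hcont] with ω hω hmem
  obtain ⟨k, hk⟩ := Set.mem_iUnion.1 hmem
  exact le_trans hk (le_runningMax hω (uniformGrid_le_one n k))

lemma setLIntegral_lt_runningMax_enorm_sub_le (hX : ∀ t, AEMeasurable (X t) P)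
    (hcont : ∀ᵐ ω ∂P, Continuous (X · ω))
    (hindep : ∀ t ≤ 1, IndepFun (X 1 - X t) (fun ω (s : Set.Iic t) ↦ X s ω) P)
    (hc : ∀ t ≤ 1, ∫⁻ ω, ‖X 1 ω - X t ω‖ₑ ∂P ≤ c) {b : ℝ} (h0 : ∀ᵐ ω ∂P, X 0 ω < b) :
    ∫⁻ ω in {ω | b < runningMax X ω}, ‖X 1 ω - b‖ₑ ∂P ≤ c * P {ω | b ≤ runningMax X ω} := by
  have hlt : NullMeasurableSet {ω | b < runningMax X ω} P :=
    nullMeasurableSet_lt aemeasurable_const (aemeasurable_runningMax hX hcont)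
  refine lintegral_le_of_tendsto_of_forall_lintegral_le (fun n ↦ ?_)
    ((ae_restrict_iff'₀ hlt).2 ?_)
    (fun n ↦ (setLIntegral_le_lintegral _ _).trans
      (lintegral_tsum_indicator_firstHit_uniformGrid_le hX hcont hindep hc b n))
    tendsto_const_nhds
  · exact (AEMeasurable.tsum fun k ↦ ((hX 1).sub (hX _)).enorm.indicator₀
      (nullMeasurableSet_firstHit (fun k ↦ hX _) measurableSet_Ici k)).restrict
  · filter_upwards [hcont, h0] with ω hω h0ω hb using
      tendsto_tsum_indicator_firstHit_uniformGrid hω h0ω hb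

lemma setLIntegral_le_runningMax_enorm_sub_le [IsFiniteMeasure P] (hX : ∀ t, AEMeasurable (X t) P)
    (hcont : ∀ᵐ ω ∂P, Continuous (X · ω))
    (hindep : ∀ t ≤ 1, IndepFun (X 1 - X t) (fun ω (s : Set.Iic t) ↦ X s ω) P)
    (hc : ∀ t ≤ 1, ∫⁻ ω, ‖X 1 ω - X t ω‖ₑ ∂P ≤ c) (hc_top : c ≠ ∞) {x a : ℝ}
    (h0 : ∀ᵐ ω ∂P, X 0 ω ≤ x) (hxa : x < a) :
    ∫⁻ ω in {ω | a ≤ runningMax X ω}, ‖X 1 ω - a‖ₑ ∂P ≤ c * P {ω | a ≤ runningMax X ω} := by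
  obtain ⟨u, hu_mono, hu_mem, hua⟩ := exists_seq_strictMono_tendsto' hxa
  refine lintegral_le_of_tendsto_of_forall_lintegral_le (F := fun n ω ↦ ‖X 1 ω - u n‖ₑ)
    (fun n ↦ ((hX 1).sub_const _).enorm.restrict)
    (.of_forall fun ω ↦ (tendsto_const_nhds.sub hua).enorm) (fun n ↦ ?_)
    (ENNReal.Tendsto.const_mul
      (tendsto_measure_le_of_monotone (aemeasurable_runningMax hX hcont) hu_mono.monotone hua)
      (.inr hc_top))
  calc ∫⁻ ω in {ω | a ≤ runningMax X ω}, ‖X 1 ω - u n‖ₑ ∂P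
      ≤ ∫⁻ ω in {ω | u n < runningMax X ω}, ‖X 1 ω - u n‖ₑ ∂P :=
        lintegral_mono_set fun ω hω ↦ (hu_mem n).2.trans_le hω
    _ ≤ c * P {ω | u n ≤ runningMax X ω} :=
        setLIntegral_lt_runningMax_enorm_sub_le hX hcont hindep hc
          (h0.mono fun _ h ↦ h.trans_lt (hu_mem n).1)

end PassageLevel

section Brownian

variable {Ω : Type*} [MeasurableSpace Ω] {P : Measure Ω} {W : ℝ≥0 → Ω → ℝ}

lemma indepFun_sub_past_of_isPreBrownianReal (hW : IsPreBrownianReal W P) {s t : ℝ≥0}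
    (hst : s ≤ t) : IndepFun (W t - W s) (fun ω (r : Set.Iic s) ↦ W r ω) P := by
  have hshift : W t - W s = fun ω ↦ W (s + (t - s)) ω - W s ω := by
    rw [add_tsub_cancel_of_le hst]
    rfl
  rw [hshift]
  exact (hW.indepFun_shift s).comp (measurable_pi_apply (t - s)) measurable_id

lemma lintegral_enorm_sub_of_isPreBrownianReal (hW : IsPreBrownianReal W P) (s t : ℝ≥0) :
    ∫⁻ ω, ‖W s ω - W t ω‖ₑ ∂P = ENNReal.ofReal √(2 * dist s t / Real.pi) := by
  calc ∫⁻ ω, ‖W s ω - W t ω‖ₑ ∂P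
      = ∫⁻ x, ‖x - 0‖ₑ ∂gaussianReal 0 (nndist (s : ℝ) t) := by
        simp only [sub_zero]
        exact (hW.hasLaw_sub s t).lintegral_comp measurable_enorm.aemeasurable
    _ = ENNReal.ofReal (∫ x, |x - 0| ∂gaussianReal 0 (nndist (s : ℝ) t)) :=
        (ofReal_integral_norm_eq_lintegral_enorm
          (IsGaussian.integrable_id.sub (integrable_const 0))).symm
    _ = ENNReal.ofReal √(2 * dist s t / Real.pi) := by
        rw [integral_abs_sub_gaussianReal]
        rfl

lemma lintegral_enorm_one_sub_le_of_isPreBrownianReal (hW : IsPreBrownianReal W P) {t : ℝ≥0}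
    (ht : t ≤ 1) : ∫⁻ ω, ‖W 1 ω - W t ω‖ₑ ∂P ≤ ENNReal.ofReal √(2 / Real.pi) := by
  have hdist : dist 1 t ≤ 1 :=
    Real.dist_le_of_mem_Icc_01 ⟨zero_le_one, le_rfl⟩ ⟨t.2, NNReal.coe_le_one.2 ht⟩
  rw [lintegral_enorm_sub_of_isPreBrownianReal hW]
  gcongr
  linarith

lemma measure_le_pos_of_isPreBrownianReal (hW : IsPreBrownianReal W P) {t : ℝ≥0} (ht : t ≠ 0)
    (a : ℝ) : 0 < P {ω | a ≤ W t ω} := by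
  have hlaw := hW.hasLaw_eval t
  calc 0 < gaussianReal 0 t (Set.Ici a) :=
        pos_iff_ne_zero.2 fun h ↦ by simpa using gaussianReal_absolutelyContinuous' 0 ht h
    _ = P (W t ⁻¹' Set.Ici a) := by
      rw [← hlaw.map_eq, Measure.map_apply_of_aemeasurable hlaw.aemeasurable measurableSet_Ici]

end Brownian

theorem mainTheorem4_general {Ω : Type*} [MeasurableSpace Ω] (P : Measure Ω) [IsFiniteMeasure P]
    (X : ℝ≥0 → Ω → ℝ) (hX : ∀ t, AEMeasurable (X t) P) (hcont : ∀ᵐ ω ∂P, Continuous (X · ω))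
    (h0 : ∀ᵐ ω ∂P, X 0 ω ≤ 0)
    (hindep : ∀ t ≤ 1, IndepFun (X 1 - X t) (fun ω (s : Set.Iic t) ↦ X s ω) P)
    (C : ℝ≥0) (hC : ∀ t ≤ 1, ∫⁻ ω, ‖X 1 ω - X t ω‖ₑ ∂P ≤ C)
    (hpos : ∀ a : ℝ, 0 < P {ω | a ≤ X 1 ω}) :
    (∀ ε : ℝ, 0 < ε →
      NullMeasurableSet (highMaxEvent X ε) P ∧
      0 < P (highMaxEvent X ε) ∧
      Integrable (fun ω => |ε * X 1 ω - 1|) (cond P (highMaxEvent X ε)) ∧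
      ∫ ω, |ε * X 1 ω - 1| ∂(cond P (highMaxEvent X ε)) ≤ ε * C) ∧
    Tendsto (fun ε : ℝ => ∫ ω, |ε * X 1 ω - 1| ∂(cond P (highMaxEvent X ε)))
      (𝓝[>] 0) (𝓝 0) := by
  have bound (ε : ℝ) (hε : 0 < ε) :
      Integrable (fun ω ↦ |ε * X 1 ω - 1|) P[|highMaxEvent X ε] ∧
        ∫ ω, |ε * X 1 ω - 1| ∂P[|highMaxEvent X ε] ≤ ε * C := by
    refine integrable_and_integral_abs_le_of_lintegral_enorm_le
      ((((hX 1).const_mul ε).sub_const 1).mono_ac cond_absolutelyContinuous).aestronglyMeasurable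
      (by positivity) ?_
    rw [lintegral_enorm_mul_sub_one _ hε.ne', Real.enorm_of_nonneg hε.le, ENNReal.ofReal_mul hε.le,
      ENNReal.ofReal_coe_nnreal]
    gcongr
    exact lintegral_cond_le_of_setLIntegral_le <| setLIntegral_le_runningMax_enorm_sub_le hX hcont
      hindep hC ENNReal.coe_ne_top h0 (one_div_pos.2 hε)
  refine ⟨fun ε hε ↦ ⟨nullMeasurableSet_le aemeasurable_const (aemeasurable_runningMax hX hcont),
    (hpos (1 / ε)).trans_le (measure_mono_ae ?_), bound ε hε⟩, ?_⟩
  · filter_upwards [hcont] with ω hω hle using le_trans hle (le_runningMax hω le_rfl)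
  · refine squeeze_zero' (.of_forall fun ε ↦ integral_nonneg fun ω ↦ abs_nonneg _)
      (eventually_mem_nhdsWithin.mono fun ε hε ↦ (bound ε hε).2) ?_
    exact ((continuous_id.mul continuous_const).tendsto' 0 0 (zero_mul _)).mono_left
      nhdsWithin_le_nhds

theorem mainTheorem4 {Ω : Type*} [MeasurableSpace Ω] (P : Measure Ω) [IsProbabilityMeasure P]
    (W : ℝ≥0 → Ω → ℝ) (hW : IsBrownianReal W P) :
    (∀ ε : ℝ, 0 < ε →
      NullMeasurableSet (highMaxEvent W ε) P ∧
      0 < P (highMaxEvent W ε) ∧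
      Integrable (fun ω => |ε * W 1 ω - 1|) (cond P (highMaxEvent W ε)) ∧
      ∫ ω, |ε * W 1 ω - 1| ∂(cond P (highMaxEvent W ε)) ≤ ε * √(2 / Real.pi)) ∧
    Tendsto (fun ε : ℝ => ∫ ω, |ε * W 1 ω - 1| ∂(cond P (highMaxEvent W ε)))
      (𝓝[>] 0) (𝓝 0) := by
  have hB := hW.toIsPreBrownianReal
  simpa only [Real.coe_toNNReal _ (Real.sqrt_nonneg _)] using
    mainTheorem4_general P W hB.aemeasurable hW.cont (hB.eval_zero_ae_eq_zero.mono fun _ h ↦ h.le)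
      (fun t ht ↦ indepFun_sub_past_of_isPreBrownianReal hB ht) (√(2 / Real.pi)).toNNReal
      (fun t ht ↦ lintegral_enorm_one_sub_le_of_isPreBrownianReal hB ht)
      (measure_le_pos_of_isPreBrownianReal hB one_ne_zero)
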